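/- All graphs are finite and simple. Let $G$ be a graph with adjacency matrix $A(G)$ and diagonal matrix of vertex degrees $D(G)$. For real $\alpha$ put $A_\alpha(G)=\alpha D(G)+(1-\alpha)A(G)$; the $A_\alpha$-index $\lambda_\alpha(G)$ of $G$ is the largest eigenvalue of this real symmetric matrix. A dissociation set of $G$ is a set $S$ of vertices such that the induced subgraph $G[S]$ has all vertex degrees at most $1$, and the dissociation number of $G$ is the largest cardinality of a dissociation set of $G$. For natural numbers $n,\tau$ let $\mathcal G_n^\tau$ denote the set of connected graphs with $n$ vertices and dissociation number $\tau$. **Theorem.** Let $n$ and $\tau$ be natural numbers with $\tau\ge\lceil 2n/3\rceil$, and let $\alpha$ be a real number with $0\le\alpha<1$. If $G^\dagger\in\mathcal G_n^\tau$ satisfies $\lambda_\alpha(G^\dagger)\le\lambda_\alpha(H)$ for every $H\in\mathcal G_n^\tau$, then $G^\dagger$ is a tree. -/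

import Mathlib

namespace DissociationIndex

open Classical in
/-- `S` is a dissociation set of `G`: every vertex of the induced subgraph `G[S]` has degree at
most one, that is, every vertex of `S` has at most one neighbour in `S`. -/
def IsDissociationSet {V : Type*} (G : SimpleGraph V) (S : Finset V) : Prop :=
  ∀ v ∈ S, (S.filter (fun u => G.Adj v u)).card ≤ 1

open Classical in
/-- The dissociation number of `G`: the largest cardinality of a dissociation set. -/
noncomputable def dissociationNumber {V : Type*} [Fintype V] (G : SimpleGraph V) : ℕ :=
  ((Finset.univ : Finset (Finset V)).filter (fun S => IsDissociationSet G S)).sup Finset.card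

open Classical in
/-- The matrix `A_α(G) = α D(G) + (1 - α) A(G)`, where `D(G)` is the diagonal matrix of the vertex
degrees and `A(G)` is the adjacency matrix. -/
noncomputable def alphaMatrix {V : Type*} [Fintype V] (α : ℝ) (G : SimpleGraph V) :
    Matrix V V ℝ :=
  α • G.degMatrix ℝ + (1 - α) • G.adjMatrix ℝ

open Classical in
/-- The `A_α`-index of `G`: the largest eigenvalue of `A_α(G)` (see `isGreatest_alphaIndex`). -/
noncomputable def alphaIndex {V : Type*} [Fintype V] (α : ℝ) (G : SimpleGraph V) : ℝ :=
  sSup {μ : ℝ | Module.End.HasEigenvalue (Matrix.toLin' (alphaMatrix α G)) μ}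

/-- The connected graphs on the vertex set `V` with dissociation number `τ`. Every connected graph
of order `|V|` with dissociation number `τ` is isomorphic to one of these. -/
def connectedGraphs (V : Type*) [Fintype V] (τ : ℕ) : Set (SimpleGraph V) :=
  {G | G.Connected ∧ dissociationNumber G = τ}

theorem isHermitian_alphaMatrix {V : Type*} [Fintype V] (α : ℝ) (G : SimpleGraph V) :
    (alphaMatrix α G).IsHermitian := by
  classical
  unfold alphaMatrix
  rw [Matrix.IsHermitian, Matrix.conjTranspose_eq_transpose_of_trivial, Matrix.transpose_add,
    Matrix.transpose_smul, Matrix.transpose_smul, SimpleGraph.transpose_adjMatrix,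
    SimpleGraph.degMatrix, Matrix.diagonal_transpose]

open Classical in
/-- On a nonempty vertex set the `A_α`-index really is the largest eigenvalue. -/
theorem isGreatest_alphaIndex {V : Type*} [Fintype V] [Nonempty V] (α : ℝ) (G : SimpleGraph V) :
    IsGreatest {μ : ℝ | Module.End.HasEigenvalue (Matrix.toLin' (alphaMatrix α G)) μ}
      (alphaIndex α G) := by
  have hfin : {μ : ℝ | Module.End.HasEigenvalue (Matrix.toLin' (alphaMatrix α G)) μ}.Finite :=
    Module.End.finite_hasEigenvalue _
  have hne : {μ : ℝ | Module.End.HasEigenvalue (Matrix.toLin' (alphaMatrix α G)) μ}.Nonempty := by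
    let v : V := Classical.arbitrary V
    refine ⟨(isHermitian_alphaMatrix α G).eigenvalues v, ?_⟩
    have h := (isHermitian_alphaMatrix α G).eigenvalues_mem_spectrum_real v
    rw [← Matrix.spectrum_toLin'] at h
    exact Module.End.hasEigenvalue_iff_mem_spectrum.mpr h
  exact ⟨hne.csSup_mem hfin, fun μ hμ => le_csSup hfin.bddAbove hμ⟩

end DissociationIndex

namespace DissociationIndex

open scoped Classical Matrix

/-! If a minimiser `G` were not a tree, a proper spanning tree `T` would have strictly smaller index
(`alphaIndex_lt_of_lt`), by positivity of the Perron vector, and dissociation number at least `τ`.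
It remains to lower the dissociation number of `T` to exactly `τ` without raising the index.

In a tree with a vertex of degree at least 3, take such a vertex `b` joined to a leaf `y` by a
pendant path, and move a branch of `b` to `y`. The index does not grow (`alphaIndex_switchEdge_le`),
the number of leaves drops, and the dissociation number falls by at most one, so `τ` cannot be
jumped over. A tree without branch vertices satisfies 3·diss ≤ 2n+2
(`three_mul_dissociationNumber_le`), so the process cannot get stuck above `τ ≥ 2n/3`. The resulting
tree contradicts the minimality of `G`. -/

/-- The contribution of one ordered pair of adjacent vertices, carrying the values `s` and `t`, to
the quadratic form of `A_α`. -/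
noncomputable def pairWeight (α s t : ℝ) : ℝ := α * (s ^ 2 + t ^ 2) / 2 + (1 - α) * (s * t)

theorem pairWeight_comm (α s t : ℝ) : pairWeight α s t = pairWeight α t s := by
  unfold pairWeight; ring

theorem pairWeight_mono {α s s' t : ℝ} (hα0 : 0 ≤ α) (hα1 : α ≤ 1) (hs : 0 ≤ s) (ht : 0 ≤ t)
    (h : s ≤ s') : pairWeight α s t ≤ pairWeight α s' t := by
  unfold pairWeight
  have h1 : s ^ 2 ≤ s' ^ 2 := by gcongr
  have h2 : s * t ≤ s' * t := by gcongr
  have h3 := mul_le_mul_of_nonneg_left h1 hα0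
  have h4 := mul_le_mul_of_nonneg_left h2 (sub_nonneg.2 hα1)
  linarith

theorem pairWeight_pos {α s t : ℝ} (hα0 : 0 ≤ α) (hα1 : α < 1) (hs : 0 < s) (ht : 0 < t) :
    0 < pairWeight α s t := by
  unfold pairWeight
  have := mul_pos (sub_pos.2 hα1) (mul_pos hs ht)
  positivity

theorem pairWeight_le_abs {α s t : ℝ} (hα1 : α ≤ 1) :
    pairWeight α s t ≤ pairWeight α |s| |t| := by
  unfold pairWeight
  rw [sq_abs, sq_abs, ← abs_mul]
  have := mul_le_mul_of_nonneg_left (le_abs_self (s * t)) (sub_nonneg.2 hα1)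
  linarith

/-! ### Rayleigh quotients and Perron vectors of `A_α`. -/

section Spectral

variable {V : Type*} [Fintype V]

/-- The quadratic form of `A_α(G)`, as a sum over ordered pairs of adjacent vertices. -/
noncomputable def energy (α : ℝ) (G : SimpleGraph V) (x : V → ℝ) : ℝ :=
  ∑ u, ∑ v, if G.Adj u v then pairWeight α (x u) (x v) else 0

theorem alphaMatrix_mulVec_apply (α : ℝ) (G : SimpleGraph V) (x : V → ℝ) (u : V) :
    (alphaMatrix α G *ᵥ x) u = ∑ v, if G.Adj u v then α * x u + (1 - α) * x v else 0 := by
  have hd : (G.degree u : ℝ) = ∑ v, if G.Adj u v then (1 : ℝ) else 0 :=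
    G.degree_eq_sum_if_adj u
  have hA : (G.adjMatrix ℝ *ᵥ x) u = ∑ v, if G.Adj u v then x v else 0 := by
    simp [Matrix.mulVec, dotProduct, SimpleGraph.adjMatrix_apply]
  rw [alphaMatrix, Matrix.add_mulVec, Matrix.smul_mulVec, Matrix.smul_mulVec, Pi.add_apply,
    Pi.smul_apply, Pi.smul_apply, G.degMatrix_mulVec_apply, hA, hd, smul_eq_mul, smul_eq_mul,
    Finset.sum_mul, Finset.mul_sum, Finset.mul_sum, ← Finset.sum_add_distrib]
  refine Finset.sum_congr rfl fun v _ => ?_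
  split_ifs <;> ring

/-- The degree term puts `α x_u²` on each ordered pair; averaging with the sum in swapped order
gives the symmetric `pairWeight`. -/
theorem dotProduct_alphaMatrix_mulVec (α : ℝ) (G : SimpleGraph V) (x : V → ℝ) :
    x ⬝ᵥ (alphaMatrix α G *ᵥ x) = energy α G x := by
  have h1 : x ⬝ᵥ (alphaMatrix α G *ᵥ x) =
      ∑ u, ∑ v, if G.Adj u v then α * x u ^ 2 + (1 - α) * (x u * x v) else 0 := by
    refine Finset.sum_congr rfl fun u _ => ?_
    rw [alphaMatrix_mulVec_apply, Finset.mul_sum]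
    refine Finset.sum_congr rfl fun v _ => ?_
    split_ifs <;> ring
  have h2 : x ⬝ᵥ (alphaMatrix α G *ᵥ x) =
      ∑ u, ∑ v, if G.Adj u v then α * x v ^ 2 + (1 - α) * (x u * x v) else 0 := by
    rw [h1, Finset.sum_comm]
    refine Finset.sum_congr rfl fun u _ => Finset.sum_congr rfl fun v _ => ?_
    rw [G.adj_comm, mul_comm (x v)]
  have h3 : x ⬝ᵥ (alphaMatrix α G *ᵥ x) + x ⬝ᵥ (alphaMatrix α G *ᵥ x) =
      energy α G x + energy α G x := by
    nth_rw 1 [h1]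
    rw [h2]
    simp only [energy, ← Finset.sum_add_distrib]
    refine Finset.sum_congr rfl fun u _ => Finset.sum_congr rfl fun v _ => ?_
    unfold pairWeight
    split_ifs <;> ring
  linarith

theorem posSemidef_alphaIndex_sub [Nonempty V] (α : ℝ) (G : SimpleGraph V) :
    (alphaIndex α G • (1 : Matrix V V ℝ) - alphaMatrix α G).PosSemidef := by
  have hH : (alphaIndex α G • (1 : Matrix V V ℝ) - alphaMatrix α G).IsHermitian := by
    refine Matrix.IsHermitian.sub ?_ (isHermitian_alphaMatrix α G)
    simp [Matrix.IsHermitian]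
  rw [hH.posSemidef_iff_eigenvalues_nonneg]
  intro i
  have h := hH.eigenvalues_mem_spectrum_real i
  rw [← Matrix.spectrum_toLin'] at h
  obtain ⟨v, hv⟩ := (Module.End.hasEigenvalue_iff_mem_spectrum.mpr h).exists_hasEigenvector
  have hv1 := hv.apply_eq_smul
  rw [Matrix.toLin'_apply, Matrix.sub_mulVec, Matrix.smul_mulVec, Matrix.one_mulVec] at hv1
  -- An eigenvalue `θ` of `λI - A_α` makes `λ - θ` an eigenvalue of `A_α`, hence at most `λ`.
  have h2 : Module.End.HasEigenvalue (Matrix.toLin' (alphaMatrix α G))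
      (alphaIndex α G - hH.eigenvalues i) := by
    refine Module.End.hasEigenvalue_of_hasEigenvector (x := v) ⟨?_, hv.2⟩
    rw [Module.End.mem_eigenspace_iff, Matrix.toLin'_apply, sub_smul, ← hv1]
    abel
  have := (isGreatest_alphaIndex α G).2 h2
  simpa using this

theorem dotProduct_alphaIndex_sub (α : ℝ) (G : SimpleGraph V) (x : V → ℝ) :
    x ⬝ᵥ ((alphaIndex α G • (1 : Matrix V V ℝ) - alphaMatrix α G) *ᵥ x) =
      alphaIndex α G * ∑ v, x v ^ 2 - energy α G x := by
  rw [Matrix.sub_mulVec, Matrix.smul_mulVec, Matrix.one_mulVec, dotProduct_sub,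
    dotProduct_alphaMatrix_mulVec, dotProduct_smul, smul_eq_mul]
  simp [dotProduct, sq]

theorem energy_le_alphaIndex_mul [Nonempty V] (α : ℝ) (G : SimpleGraph V) (x : V → ℝ) :
    energy α G x ≤ alphaIndex α G * ∑ v, x v ^ 2 := by
  have h := (posSemidef_alphaIndex_sub α G).dotProduct_mulVec_nonneg x
  rw [star_trivial, dotProduct_alphaIndex_sub] at h
  linarith

theorem alphaMatrix_mulVec_of_energy_eq [Nonempty V] {α : ℝ} {G : SimpleGraph V} {x : V → ℝ}
    (h : energy α G x = alphaIndex α G * ∑ v, x v ^ 2) :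
    alphaMatrix α G *ᵥ x = alphaIndex α G • x := by
  have h0 := ((posSemidef_alphaIndex_sub α G).dotProduct_mulVec_zero_iff x).1 (by
    rw [star_trivial, dotProduct_alphaIndex_sub, h, sub_self])
  rw [Matrix.sub_mulVec, Matrix.smul_mulVec, Matrix.one_mulVec] at h0
  exact (sub_eq_zero.1 h0).symm

theorem sum_sq_pos_of_ne_zero {x : V → ℝ} (hx : x ≠ 0) : 0 < ∑ v, x v ^ 2 := by
  obtain ⟨v, hv⟩ := Function.ne_iff.1 hx
  exact Finset.sum_pos' (fun _ _ => sq_nonneg _) ⟨v, Finset.mem_univ v, by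
    have : x v ≠ 0 := hv
    positivity⟩

/-- The `A_α`-index is attained by the quadratic form at a nonnegative vector. -/
theorem exists_nonneg_energy_eq [Nonempty V] {α : ℝ} (hα1 : α ≤ 1) (G : SimpleGraph V) :
    ∃ x : V → ℝ, x ≠ 0 ∧ (∀ v, 0 ≤ x v) ∧ energy α G x = alphaIndex α G * ∑ v, x v ^ 2 := by
  obtain ⟨w, hw⟩ := ((isGreatest_alphaIndex α G).1).exists_hasEigenvector
  have hw1 := hw.apply_eq_smul
  rw [Matrix.toLin'_apply] at hw1
  have hE : energy α G w = alphaIndex α G * ∑ v, w v ^ 2 := by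
    rw [← dotProduct_alphaMatrix_mulVec, hw1, dotProduct_smul, smul_eq_mul]
    simp [dotProduct, sq]
  refine ⟨fun v => |w v|, ?_, fun v => abs_nonneg _, le_antisymm (energy_le_alphaIndex_mul _ _ _) ?_⟩
  · intro h
    exact hw.2 (funext fun v => abs_eq_zero.1 (congrFun h v))
  · simp only [sq_abs]
    rw [← hE]
    refine Finset.sum_le_sum fun u _ => Finset.sum_le_sum fun v _ => ?_
    split_ifs
    · exact pairWeight_le_abs hα1
    · exact le_rfl

/-- Perron–Frobenius: a nonnegative maximiser of the quadratic form of a connected graph is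
positive. -/
theorem pos_of_energy_eq [Nonempty V] {α : ℝ} (hα1 : α < 1) {G : SimpleGraph V}
    (hG : G.Connected) {x : V → ℝ} (hx : x ≠ 0) (hx0 : ∀ v, 0 ≤ x v)
    (hE : energy α G x = alphaIndex α G * ∑ v, x v ^ 2) (v : V) : 0 < x v := by
  -- At a zero of `x` the eigenvalue equation says that a sum of nonnegative terms vanishes, so
  -- zeros spread to neighbours.
  have hstep : ∀ u w, G.Adj u w → x u = 0 → x w = 0 := by
    intro u w huw hu
    have h := congrFun (alphaMatrix_mulVec_of_energy_eq hE) u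
    rw [alphaMatrix_mulVec_apply, Pi.smul_apply, hu, smul_zero] at h
    have h' := (Finset.sum_eq_zero_iff_of_nonneg (fun c _ => by
      split_ifs
      · have := mul_nonneg (sub_nonneg.2 hα1.le) (hx0 c)
        linarith
      · exact le_rfl)).1 h w (Finset.mem_univ w)
    rw [if_pos huw, mul_zero, zero_add] at h'
    exact (mul_eq_zero.1 h').resolve_left (sub_pos.2 hα1).ne'
  refine (hx0 v).lt_of_ne fun hv => hx (funext fun w => ?_)
  obtain ⟨p⟩ := hG.preconnected v w
  have : ∀ {a c : V}, G.Walk a c → x a = 0 → x c = 0 := by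
    intro a c q
    induction q with
    | nil => exact id
    | cons h _ ih => exact fun h0 => ih (hstep _ _ h h0)
  exact this p hv.symm

theorem alphaIndex_le_of_energy_le [Nonempty V] {α : ℝ} {G H : SimpleGraph V} {x y : V → ℝ}
    (hx : x ≠ 0) (hE : energy α H x = alphaIndex α H * ∑ v, x v ^ 2)
    (hxy : ∑ v, y v ^ 2 = ∑ v, x v ^ 2) (h : energy α H x ≤ energy α G y) :
    alphaIndex α H ≤ alphaIndex α G := by
  have h1 := energy_le_alphaIndex_mul α G y
  rw [hxy] at h1
  exact le_of_mul_le_mul_right (by linarith) (sum_sq_pos_of_ne_zero hx)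

/-- Deleting edges of a graph strictly decreases the `A_α`-index, as long as the remaining spanning
subgraph is connected. -/
theorem alphaIndex_lt_of_lt {α : ℝ} (hα0 : 0 ≤ α) (hα1 : α < 1)
    {G H : SimpleGraph V} (hH : H.Connected) (hlt : H < G) :
    alphaIndex α H < alphaIndex α G := by
  have := hH.nonempty
  obtain ⟨x, hx, hx0, hE⟩ := exists_nonneg_energy_eq hα1.le H
  have hpos := pos_of_energy_eq hα1 hH hx hx0 hE
  obtain ⟨a, b, hab, hab'⟩ : ∃ a b, G.Adj a b ∧ ¬ H.Adj a b := by
    by_contra! hc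
    exact hlt.not_ge fun a b => hc a b
  have hterm : ∀ u v, (if H.Adj u v then pairWeight α (x u) (x v) else 0) ≤
      if G.Adj u v then pairWeight α (x u) (x v) else 0 := by
    intro u v
    by_cases h : H.Adj u v
    · rw [if_pos h, if_pos (hlt.le h)]
    · rw [if_neg h]
      split_ifs
      · exact (pairWeight_pos hα0 hα1 (hpos u) (hpos v)).le
      · exact le_rfl
  have hlt' : energy α H x < energy α G x := by
    refine Finset.sum_lt_sum (fun u _ => Finset.sum_le_sum fun v _ => hterm u v)
      ⟨a, Finset.mem_univ a, Finset.sum_lt_sum (fun v _ => hterm a v) ⟨b, Finset.mem_univ b, ?_⟩⟩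
    rw [if_neg hab', if_pos hab]
    exact pairWeight_pos hα0 hα1 (hpos a) (hpos b)
  have h1 := energy_le_alphaIndex_mul α G x
  exact lt_of_mul_lt_mul_right (by linarith) (sum_sq_pos_of_ne_zero hx).le

theorem energy_sup_edge (α : ℝ) {K : SimpleGraph V} {u w : V} (huw : u ≠ w) (h : ¬ K.Adj u w)
    (x : V → ℝ) :
    energy α (K ⊔ SimpleGraph.edge u w) x = energy α K x + 2 * pairWeight α (x u) (x w) := by
  have h1 : energy α (K ⊔ SimpleGraph.edge u w) x =
      ∑ a, ∑ c, ((if K.Adj a c then pairWeight α (x a) (x c) else 0) +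
      ((if a = u then if c = w then pairWeight α (x u) (x w) else 0 else 0) +
       (if a = w then if c = u then pairWeight α (x u) (x w) else 0 else 0))) := by
    refine Finset.sum_congr rfl fun a _ => Finset.sum_congr rfl fun c _ => ?_
    have h' : ¬ K.Adj w u := fun hh => h hh.symm
    have := pairWeight_comm α (x u) (x w)
    simp only [SimpleGraph.sup_adj, SimpleGraph.edge_adj]
    grind
  rw [h1]
  simp only [energy, Finset.sum_add_distrib]
  simp
  ring

/-- Edges inside `P` are merely permuted and edges outside are untouched. Every edge leaving `P`
does so at `b`, where the value does not decrease. -/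
theorem energy_le_energy_comp_perm {α : ℝ} (hα0 : 0 ≤ α) (hα1 : α ≤ 1) {K : SimpleGraph V}
    {σ : Equiv.Perm V} {P : Set V} {b : V} (hP : ∀ v, σ v ∈ P ↔ v ∈ P)
    (hfix : ∀ v, v ∉ P → σ v = v)
    (hadj : ∀ u ∈ P, ∀ v ∈ P, (K.Adj (σ u) (σ v) ↔ K.Adj u v))
    (hout : ∀ u ∈ P, ∀ v, v ∉ P → K.Adj u v → u = b)
    {x : V → ℝ} (hx0 : ∀ v, 0 ≤ x v) (hb : x b ≤ x (σ b)) :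
    energy α K x ≤ energy α K (x ∘ σ) := by
  -- `g` is the part of the energy inside `P`; only the total is invariant, so it is split off
  -- before comparing termwise.
  let g : (V → ℝ) → V → V → ℝ := fun y u v =>
    if u ∈ P ∧ v ∈ P ∧ K.Adj u v then pairWeight α (y u) (y v) else 0
  have hg : ∑ u, ∑ v, g (x ∘ σ) u v = ∑ u, ∑ v, g x u v := by
    rw [← Equiv.sum_comp σ (fun u => ∑ v, g x u v)]
    refine Finset.sum_congr rfl fun u _ => ?_
    rw [← Equiv.sum_comp σ (fun v => g x (σ u) v)]
    refine Finset.sum_congr rfl fun v _ => ?_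
    simp only [g, hP, Function.comp]
    refine if_congr ⟨fun h => ⟨h.1, h.2.1, (hadj u h.1 v h.2.1).2 h.2.2⟩,
      fun h => ⟨h.1, h.2.1, (hadj u h.1 v h.2.1).1 h.2.2⟩⟩ rfl rfl
  have hterm : ∀ u v, (if K.Adj u v then pairWeight α (x u) (x v) else 0) - g x u v ≤
      (if K.Adj u v then pairWeight α ((x ∘ σ) u) ((x ∘ σ) v) else 0) - g (x ∘ σ) u v := by
    intro u v
    by_cases huv : K.Adj u v
    · by_cases hu : u ∈ P <;> by_cases hv : v ∈ P
      · simp [g, huv, hu, hv]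
      · obtain rfl := hout u hu v hv huv
        simpa [g, huv, hu, hv, hfix v hv] using pairWeight_mono hα0 hα1 (hx0 _) (hx0 _) hb
      · obtain rfl := hout v hv u hu huv.symm
        simp only [g, huv, hu, hv, hfix u hu, Function.comp, if_true, false_and, if_false,
          sub_zero]
        rw [pairWeight_comm, pairWeight_comm α (x u)]
        exact pairWeight_mono hα0 hα1 (hx0 _) (hx0 _) hb
      · simp [g, hu, hfix u hu, hfix v hv]
    · simp [g, huv]
  have hsum := Finset.sum_le_sum fun u (_ : u ∈ Finset.univ) =>
    Finset.sum_le_sum fun v (_ : v ∈ Finset.univ) => hterm u v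
  simp only [Finset.sum_sub_distrib] at hsum
  unfold energy
  linarith

end Spectral

/-! ### Pendant paths and edge switching in trees. -/

section Switching

variable {V : Type*}

/-- `p 0, …, p k` is a path of `G` all of whose vertices but `p 0` have no neighbours in `G` apart
from those on the path. -/
structure IsPendantPath (G : SimpleGraph V) (p : ℕ → V) (k : ℕ) : Prop where
  injOn : ∀ i ≤ k, ∀ j ≤ k, p i = p j → i = j
  adj : ∀ i < k, G.Adj (p i) (p (i + 1))
  nbr : ∀ i, 0 < i → i ≤ k → ∀ w, G.Adj (p i) w → ∃ j ≤ k, p j = w ∧ (j + 1 = i ∨ i + 1 = j)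

namespace IsPendantPath

variable {G : SimpleGraph V} {p : ℕ → V} {k : ℕ}

theorem adj_iff (h : IsPendantPath G p k) {i j : ℕ} (hi : i ≤ k) (hj : j ≤ k) :
    G.Adj (p i) (p j) ↔ (j + 1 = i ∨ i + 1 = j) := by
  constructor
  · intro hij
    rcases Nat.eq_zero_or_pos i with rfl | hi0
    · rcases Nat.eq_zero_or_pos j with rfl | hj0
      · exact absurd rfl hij.ne
      · obtain ⟨l, hl, hl1, hl2⟩ := h.nbr j hj0 hj _ hij.symm
        have := h.injOn l hl 0 hi hl1
        omega
    · obtain ⟨l, hl, hl1, hl2⟩ := h.nbr i hi0 hi _ hij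
      have := h.injOn l hl j hj hl1
      omega
  · rintro (rfl | rfl)
    · exact (h.adj j (by omega)).symm
    · exact h.adj i (by omega)

theorem not_adj_end (h : IsPendantPath G p k) (hk : 0 < k) {z : V} (hz : ∀ i ≤ k, p i ≠ z) :
    ¬ G.Adj (p k) z := by
  intro hc
  obtain ⟨j, hj, hj1, -⟩ := h.nbr k hk le_rfl z hc
  exact hz j hj hj1

/-- The reversal of a pendant path, extended by the identity. -/
theorem exists_reversal (h : IsPendantPath G p k) :
    ∃ σ : Equiv.Perm V, (∀ i ≤ k, σ (p i) = p (k - i)) ∧ ∀ v, (∀ i ≤ k, p i ≠ v) → σ v = v := by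
  let f : V → V := fun v => if hv : ∃ i, i ≤ k ∧ p i = v then p (k - hv.choose) else v
  have hf1 : ∀ i ≤ k, f (p i) = p (k - i) := by
    intro i hi
    have hv : ∃ j, j ≤ k ∧ p j = p i := ⟨i, hi, rfl⟩
    have := h.injOn _ hv.choose_spec.1 i hi hv.choose_spec.2
    simp only [f, dif_pos hv, this]
  have hf2 : ∀ v, (∀ i ≤ k, p i ≠ v) → f v = v := by
    intro v hv
    exact dif_neg (by rintro ⟨i, hi, hiv⟩; exact hv i hi hiv)
  have hinv : Function.Involutive f := by
    intro v
    by_cases hv : ∃ i ≤ k, p i = v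
    · obtain ⟨i, hi, rfl⟩ := hv
      rw [hf1 i hi, hf1 _ (Nat.sub_le k i), Nat.sub_sub_self hi]
    · push Not at hv
      rw [hf2 v hv, hf2 v hv]
  exact ⟨hinv.toPerm f, hf1, hf2⟩

end IsPendantPath

/-- Fix a leaf and choose a path of minimal length to it from a vertex of degree at least 3;
minimality bounds the interior degrees by 2. -/
theorem exists_isPendantPath [Fintype V] [Nontrivial V] {G : SimpleGraph V} (hG : G.IsTree) {a : V}
    (ha : 3 ≤ G.degree a) :
    ∃ p k, 0 < k ∧ IsPendantPath G p k ∧ 3 ≤ G.degree (p 0) := by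
  obtain ⟨y, hy⟩ : ∃ y, G.degree y = 1 := hG.exists_vert_degree_one_of_nontrivial
  have hex : ∃ n, ∃ b, ∃ q : G.Walk b y, q.IsPath ∧ q.length = n ∧ 3 ≤ G.degree b := by
    obtain ⟨q, hq⟩ := hG.connected.exists_isPath a y
    exact ⟨_, a, q, hq, rfl, ha⟩
  obtain ⟨b, q, hq, hlen, hb⟩ := Nat.find_spec hex
  have hinner : ∀ i, 0 < i → i < q.length → G.degree (q.getVert i) ≤ 2 := by
    intro i hi hik
    by_contra! hc
    refine Nat.find_min hex (m := q.length - i) (by omega)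
      ⟨_, q.drop i, hq.drop i, q.drop_length i, hc⟩
  refine ⟨q.getVert, q.length, ?_, ⟨?_, fun i hi => q.adj_getVert_succ hi, ?_⟩, ?_⟩
  · rcases Nat.eq_zero_or_pos q.length with h0 | h0
    · have := SimpleGraph.Walk.eq_of_length_eq_zero h0
      subst this
      omega
    · exact h0
  · intro i hi j hj hij
    exact hq.getVert_injOn hi hj hij
  · intro i hi hik w hw
    have hprev : G.Adj (q.getVert i) (q.getVert (i - 1)) := by
      have := q.adj_getVert_succ (i := i - 1) (by omega)
      rw [Nat.sub_add_cancel hi] at this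
      exact this.symm
    rcases hik.lt_or_eq with hlt | rfl
    · have hnext := q.adj_getVert_succ hlt
      have hne : q.getVert (i - 1) ≠ q.getVert (i + 1) := fun hc => by
        have := hq.getVert_injOn (show i - 1 ≤ q.length by omega)
          (show i + 1 ≤ q.length by omega) hc
        omega
      have hsub : {q.getVert (i - 1), q.getVert (i + 1)} = G.neighborFinset (q.getVert i) := by
        refine Finset.eq_of_subset_of_card_le ?_ ?_
        · intro c hc
          simp only [Finset.mem_insert, Finset.mem_singleton] at hc
          rcases hc with rfl | rfl <;> simpa
        · rw [Finset.card_pair hne, G.card_neighborFinset_eq_degree]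
          exact hinner i hi hlt
      have hw' : w ∈ G.neighborFinset (q.getVert i) := by simpa
      rw [← hsub] at hw'
      simp only [Finset.mem_insert, Finset.mem_singleton] at hw'
      rcases hw' with rfl | rfl
      · exact ⟨i - 1, by omega, rfl, by omega⟩
      · exact ⟨i + 1, by omega, rfl, by omega⟩
    · rw [q.getVert_length] at hw hprev
      refine ⟨q.length - 1, by omega, ?_, by omega⟩
      have := Finset.card_le_one.1 (by rw [G.card_neighborFinset_eq_degree, hy])
        (q.getVert (q.length - 1)) (by simpa using hprev) w (by simpa using hw)
      exact this
  · rw [q.getVert_zero]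
    exact hb

/-- Replace the edge `bz` by the edge `yz`. -/
def switchEdge (G : SimpleGraph V) (b z y : V) : SimpleGraph V :=
  G.deleteEdges {s(b, z)} ⊔ SimpleGraph.edge y z

theorem deleteEdges_sup_edge {G : SimpleGraph V} {b z : V} (h : G.Adj b z) :
    G.deleteEdges {s(b, z)} ⊔ SimpleGraph.edge b z = G := by
  ext u v
  simp only [SimpleGraph.sup_adj, SimpleGraph.deleteEdges_adj, SimpleGraph.edge_adj,
    Set.mem_singleton_iff, Sym2.eq_iff]
  have := h.symm
  have := h.ne
  grind

theorem card_edgeSet_sup_edge [Finite V] {K : SimpleGraph V} {u w : V} (huw : u ≠ w) (h : ¬ K.Adj u w) :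
    Nat.card (K ⊔ SimpleGraph.edge u w).edgeSet = Nat.card K.edgeSet + 1 := by
  rw [SimpleGraph.edgeSet_sup, SimpleGraph.edgeSet_edge_of_ne huw, Set.union_singleton,
    Nat.card_coe_set_eq, Nat.card_coe_set_eq, Set.ncard_insert_of_notMem (by simpa)]

/-- The edge count is unchanged, and `b` still reaches `z` through `y`. -/
theorem isTree_switchEdge [Finite V] {G : SimpleGraph V} (hG : G.IsTree) {b z y : V} (hbz : G.Adj b z)
    (hyz : y ≠ z) (hadj : ¬ G.Adj y z) (hreach : (G.deleteEdges {s(b, z)}).Reachable b y) :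
    (switchEdge G b z y).IsTree := by
  have hle : G.deleteEdges {s(b, z)} ≤ switchEdge G b z y := le_sup_left
  have hr : (switchEdge G b z y).Reachable b z :=
    (hreach.mono hle).trans (SimpleGraph.Adj.reachable (by
      simp [switchEdge, SimpleGraph.edge_adj, hyz]))
  have hstep : ∀ u v, G.Adj u v → (switchEdge G b z y).Reachable u v := by
    intro u v huv
    by_cases he : s(u, v) = s(b, z)
    · rcases Sym2.eq_iff.1 he with ⟨rfl, rfl⟩ | ⟨rfl, rfl⟩
      · exact hr
      · exact hr.symm
    · exact (hle (by simp [huv, he])).reachable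
  obtain ⟨hconn, hcard⟩ := SimpleGraph.isTree_iff_connected_and_card.1 hG
  rw [SimpleGraph.isTree_iff_connected_and_card]
  have := hconn.nonempty
  refine ⟨⟨fun u v => ?_⟩, ?_⟩
  · obtain ⟨q⟩ := hconn.preconnected u v
    induction q with
    | nil => rfl
    | cons h _ ih => exact (hstep _ _ h).trans ih
  · rw [← hcard, switchEdge, card_edgeSet_sup_edge hyz (by simp [hadj])]
    conv_rhs => rw [← deleteEdges_sup_edge hbz]
    rw [card_edgeSet_sup_edge hbz.ne (by simp)]

/-- Moving a branch from the start of a pendant path to its end does not increase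
the `A_α`-index. -/
theorem alphaIndex_switchEdge_le [Fintype V] {α : ℝ} (hα0 : 0 ≤ α) (hα1 : α ≤ 1)
    {G : SimpleGraph V} {p : ℕ → V} {k : ℕ} (hk : 0 < k) (hp : IsPendantPath G p k) {z : V}
    (hz : ∀ i ≤ k, p i ≠ z) (hbz : G.Adj (p 0) z) :
    alphaIndex α (switchEdge G (p 0) z (p k)) ≤ alphaIndex α G := by
  have : Nonempty V := ⟨z⟩
  obtain ⟨x, hx, hx0, hE⟩ := exists_nonneg_energy_eq hα1 (switchEdge G (p 0) z (p k))
  have hG : ∀ w, energy α G w = energy α (G.deleteEdges {s(p 0, z)}) w +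
      2 * pairWeight α (w (p 0)) (w z) := by
    intro w
    conv_lhs => rw [← deleteEdges_sup_edge hbz]
    exact energy_sup_edge α hbz.ne (by simp) w
  have hH : energy α (switchEdge G (p 0) z (p k)) x = energy α (G.deleteEdges {s(p 0, z)}) x +
      2 * pairWeight α (x (p k)) (x z) :=
    energy_sup_edge α (hz k le_rfl) (by simp [hp.not_adj_end hk hz]) x
  rcases le_total (x (p k)) (x (p 0)) with hle | hle
  -- Here `x` itself is a test vector for `G`: the edge back at `p 0` weighs at least as much as at
  -- `p k`.
  · refine alphaIndex_le_of_energy_le hx hE rfl ?_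
    have := pairWeight_mono hα0 hα1 (hx0 _) (hx0 z) hle
    rw [hH, hG]
    linarith
  -- Otherwise test `G` with `x` reversed along the path: the branch at `z` sees the same value `x
  -- (p k)` as in the switched graph, and the other branches at `p 0` see a value no smaller than
  -- before.
  · obtain ⟨σ, hσ, hσ'⟩ := hp.exists_reversal
    refine alphaIndex_le_of_energy_le hx hE
      (Equiv.sum_comp σ (fun v => x v ^ 2) : ∑ v, (x ∘ σ) v ^ 2 = _) ?_
    have hσ0 : σ (p 0) = p k := hσ 0 (Nat.zero_le k)
    rw [hH, hG]
    simp only [hσ0, hσ' z hz]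
    refine add_le_add_left (energy_le_energy_comp_perm (P := {v | ∃ i ≤ k, p i = v}) (b := p 0)
      hα0 hα1 ?_ ?_ ?_ ?_ hx0 (by rwa [hσ0])) _
    · intro v
      by_cases hv : ∃ i ≤ k, p i = v
      · obtain ⟨i, hi, rfl⟩ := hv
        rw [hσ i hi]
        exact ⟨fun _ => ⟨i, hi, rfl⟩, fun _ => ⟨k - i, Nat.sub_le k i, rfl⟩⟩
      · rw [hσ' v (by push Not at hv; exact hv)]
    · intro v hv
      exact hσ' v fun i hi hiv => hv ⟨i, hi, hiv⟩
    · rintro _ ⟨i, hi, rfl⟩ _ ⟨j, hj, rfl⟩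
      have h1 := hz i hi
      have h2 := hz j hj
      have h3 := hz (k - i) (Nat.sub_le k i)
      have h4 := hz (k - j) (Nat.sub_le k j)
      simp only [hσ i hi, hσ j hj, SimpleGraph.deleteEdges_adj, Set.mem_singleton_iff, Sym2.eq_iff,
        h1, h2, h3, h4, and_false, false_and, or_false, not_false_eq_true, and_true,
        hp.adj_iff hi hj, hp.adj_iff (Nat.sub_le k i) (Nat.sub_le k j)]
      omega
    · rintro _ ⟨i, hi, rfl⟩ v hv hiv
      rcases Nat.eq_zero_or_pos i with rfl | hi0
      · rfl
      · obtain ⟨j, hj, hjv, -⟩ := hp.nbr i hi0 hi v (by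
          simp only [SimpleGraph.deleteEdges_adj] at hiv
          exact hiv.1)
        exact absurd ⟨j, hj, hjv⟩ hv

theorem IsPendantPath.reachable_deleteEdges {G : SimpleGraph V} {p : ℕ → V} {k : ℕ}
    (hp : IsPendantPath G p k) {z b : V} (hz : ∀ i ≤ k, p i ≠ z) :
    (G.deleteEdges {s(b, z)}).Reachable (p 0) (p k) := by
  have : ∀ i ≤ k, (G.deleteEdges {s(b, z)}).Reachable (p 0) (p i) := by
    intro i
    induction i with
    | zero => exact fun _ => SimpleGraph.Reachable.refl _
    | succ i ih =>
      intro hi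
      refine (ih (by omega)).trans (SimpleGraph.Adj.reachable ?_)
      have h1 := hz i (by omega)
      have h2 := hz (i + 1) hi
      simp [hp.adj i hi, h1, h2]
  exact this k le_rfl

/-! ### Dissociation numbers and leaf counts under switching. -/

theorem IsDissociationSet.mono {G H : SimpleGraph V} {S T : Finset V} (hS : IsDissociationSet G S)
    (hTS : T ⊆ S) (h : ∀ u ∈ T, ∀ v ∈ T, H.Adj u v → G.Adj u v) : IsDissociationSet H T := by
  intro v hv
  refine le_trans (Finset.card_le_card fun u hu => ?_) (hS v (hTS hv))
  simp only [Finset.mem_filter] at hu ⊢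
  exact ⟨hTS hu.1, h v hv u hu.1 hu.2⟩

variable [Fintype V]

theorem IsDissociationSet.card_le {G : SimpleGraph V} {S : Finset V} (hS : IsDissociationSet G S) :
    S.card ≤ dissociationNumber G :=
  Finset.le_sup (f := Finset.card) (by simpa using hS)

theorem exists_isDissociationSet_card_eq (G : SimpleGraph V) :
    ∃ S, IsDissociationSet G S ∧ S.card = dissociationNumber G := by
  obtain ⟨S, hS, hS'⟩ := Finset.exists_mem_eq_sup
    ((Finset.univ : Finset (Finset V)).filter (fun S => IsDissociationSet G S))
    ⟨∅, Finset.mem_filter.2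
      ⟨Finset.mem_univ _, fun v hv => absurd hv (Finset.notMem_empty v)⟩⟩ Finset.card
  exact ⟨S, by simpa using hS, hS'.symm⟩

theorem dissociationNumber_anti {G H : SimpleGraph V} (h : H ≤ G) :
    dissociationNumber G ≤ dissociationNumber H := by
  obtain ⟨S, hS, hS'⟩ := exists_isDissociationSet_card_eq G
  rw [← hS']
  exact (hS.mono subset_rfl fun u _ v _ huv => h huv).card_le

/-- Both exchanged edges contain `z`, so erasing `z` from a dissociation set of `G` leaves one of
the switched graph. -/
theorem dissociationNumber_le_switchEdge_add_one (G : SimpleGraph V) (b z y : V) :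
    dissociationNumber G ≤ dissociationNumber (switchEdge G b z y) + 1 := by
  obtain ⟨S, hS, hS'⟩ := exists_isDissociationSet_card_eq G
  have h : IsDissociationSet (switchEdge G b z y) (S.erase z) := by
    refine hS.mono (Finset.erase_subset z S) fun u hu v hv huv => ?_
    have h1 := Finset.ne_of_mem_erase hu
    have h2 := Finset.ne_of_mem_erase hv
    simp only [switchEdge, SimpleGraph.sup_adj, SimpleGraph.deleteEdges_adj,
      SimpleGraph.edge_adj] at huv
    grind
  have h1 := h.card_le
  have h2 := Finset.pred_card_le_card_erase (s := S) (a := z)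
  omega

/-- With `s = |S|`, the degree sum `2(n-1)` is at most `s` from inside `S`, plus `2(n-s)` from `S`
to its complement, plus `2(n-s)` from the complement. -/
theorem three_mul_dissociationNumber_le {G : SimpleGraph V} (hG : G.IsTree)
    (hdeg : ∀ v, G.degree v ≤ 2) : 3 * dissociationNumber G ≤ 2 * Fintype.card V + 2 := by
  obtain ⟨S, hS, hS'⟩ := exists_isDissociationSet_card_eq G
  have hcard := hG.card_edgeFinset
  have hsum := G.sum_degrees_eq_twice_card_edges
  have hsplit : ∀ v, G.degree v =
      (S.filter (fun u => G.Adj v u)).card + (Sᶜ.filter (fun u => G.Adj v u)).card := by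
    intro v
    rw [← G.card_neighborFinset_eq_degree, G.neighborFinset_eq_filter,
      ← Finset.card_union_of_disjoint (Finset.disjoint_filter_filter disjoint_compl_right),
      ← Finset.filter_union, Finset.union_compl]
  have hcross : ∑ v ∈ S, (Sᶜ.filter (fun u => G.Adj v u)).card =
      ∑ u ∈ Sᶜ, (S.filter (fun v => G.Adj u v)).card := by
    have := Finset.sum_card_bipartiteAbove_eq_sum_card_bipartiteBelow (s := S) (t := Sᶜ) G.Adj
    simp only [Finset.bipartiteAbove, Finset.bipartiteBelow] at this
    rw [this]
    simp only [G.adj_comm]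
  have h1 : ∑ v ∈ S, (S.filter (fun u => G.Adj v u)).card ≤ S.card := by
    simpa using Finset.sum_le_card_nsmul S _ 1 hS
  have h2 : ∑ u ∈ Sᶜ, (S.filter (fun v => G.Adj u v)).card ≤ ∑ u ∈ Sᶜ, G.degree u :=
    Finset.sum_le_sum fun u _ => by rw [hsplit u]; omega
  have h3 : ∑ u ∈ Sᶜ, G.degree u ≤ Sᶜ.card * 2 := by
    simpa using Finset.sum_le_card_nsmul Sᶜ (fun u => G.degree u) 2 fun u _ => hdeg u
  have h4 : ∑ v ∈ S, G.degree v = ∑ v ∈ S, (S.filter (fun u => G.Adj v u)).card +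
      ∑ v ∈ S, (Sᶜ.filter (fun u => G.Adj v u)).card := by
    rw [← Finset.sum_add_distrib]
    exact Finset.sum_congr rfl fun v _ => hsplit v
  have h5 := Finset.sum_add_sum_compl S (fun v => G.degree v)
  have h6 := S.card_add_card_compl
  omega

/-- The number of vertices of degree at most one. -/
noncomputable def leafCount (G : SimpleGraph V) : ℕ :=
  (Finset.univ.filter fun v => G.degree v ≤ 1).card

/-- The leaf `p k` gains a neighbour, `p 0` keeps degree at least 2, `z` trades one neighbour for
another, and no other neighbourhood changes. -/
theorem leafCount_switchEdge_lt {G : SimpleGraph V} {p : ℕ → V} {k : ℕ} (hk : 0 < k)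
    (hp : IsPendantPath G p k) {z : V} (hz : ∀ i ≤ k, p i ≠ z) (hbz : G.Adj (p 0) z)
    (hb : 3 ≤ G.degree (p 0)) :
    leafCount (switchEdge G (p 0) z (p k)) < leafCount G := by
  have hyz := hz k le_rfl
  have hby : p 0 ≠ p k := fun h => by
    have := hp.injOn 0 (Nat.zero_le k) k le_rfl h
    omega
  have hadj : ∀ u v, (switchEdge G (p 0) z (p k)).Adj u v ↔
      (G.Adj u v ∧ ¬ ((u = p 0 ∧ v = z) ∨ (u = z ∧ v = p 0))) ∨
        ((u = p k ∧ v = z) ∨ (u = z ∧ v = p k)) := by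
    intro u v
    simp only [switchEdge, SimpleGraph.sup_adj, SimpleGraph.deleteEdges_adj,
      SimpleGraph.edge_adj, Set.mem_singleton_iff, Sym2.eq_iff]
    grind
  have hlast : G.Adj (p k) (p (k - 1)) := (hp.adj_iff le_rfl (Nat.sub_le k 1)).2 (by omega)
  have hy : ¬ (switchEdge G (p 0) z (p k)).degree (p k) ≤ 1 := by
    rw [not_le, ← SimpleGraph.card_neighborFinset_eq_degree, Finset.one_lt_card]
    refine ⟨z, ?_, p (k - 1), ?_, (hz _ (Nat.sub_le k 1)).symm⟩
    · simp [hadj]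
    · simp [hadj, hlast, hby.symm, hyz]
  refine Finset.card_lt_card (Finset.ssubset_iff_of_subset ?_ |>.2 ⟨p k, ?_, ?_⟩)
  · intro v hv
    simp only [Finset.mem_filter, Finset.mem_univ, true_and] at hv ⊢
    rw [← SimpleGraph.card_neighborFinset_eq_degree] at hv ⊢
    by_cases hvy : v = p k
    · subst hvy
      rw [SimpleGraph.card_neighborFinset_eq_degree] at hv
      exact absurd hv hy
    by_cases hvb : v = p 0
    · subst hvb
      have hsub : G.neighborFinset (p 0) ⊆
          insert z ((switchEdge G (p 0) z (p k)).neighborFinset (p 0)) := by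
        intro w hw
        simp only [Finset.mem_insert, SimpleGraph.mem_neighborFinset, hadj] at hw ⊢
        have := hbz.ne
        grind
      have h1 := (Finset.card_le_card hsub).trans (Finset.card_insert_le _ _)
      rw [G.card_neighborFinset_eq_degree] at h1
      omega
    by_cases hvz : v = z
    · subst hvz
      have hmem : p k ∈ (switchEdge G (p 0) v (p k)).neighborFinset v := by simp [hadj]
      have hsub : G.neighborFinset v ⊆
          insert (p 0) (((switchEdge G (p 0) v (p k)).neighborFinset v).erase (p k)) := by
        intro w hw
        have h1 := hp.not_adj_end hk hz
        have h2 := G.adj_comm (p k) v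
        simp only [Finset.mem_insert, Finset.mem_erase, SimpleGraph.mem_neighborFinset, hadj]
          at hw ⊢
        grind
      have h1 := (Finset.card_le_card hsub).trans (Finset.card_insert_le _ _)
      rw [Finset.card_erase_of_mem hmem] at h1
      omega
    · refine (Finset.card_le_card fun w hw => ?_).trans hv
      simp only [SimpleGraph.mem_neighborFinset, hadj] at hw ⊢
      grind
  · simp only [Finset.mem_filter, Finset.mem_univ, true_and]
    rw [← SimpleGraph.card_neighborFinset_eq_degree, Finset.card_le_one]
    have : ∀ w, G.Adj (p k) w → w = p (k - 1) := by
      intro w hw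
      obtain ⟨j, hj, rfl, hj2⟩ := hp.nbr k hk le_rfl w hw
      congr 1
      omega
    intro u hu w hw
    rw [this u (by simpa using hu), this w (by simpa using hw)]
  · simpa using hy

/-- A tree with a vertex of degree at least three can be turned into one with fewer leaves without
increasing the `A_α`-index, while the dissociation number drops by at most one. -/
theorem exists_isTree_leafCount_lt {α : ℝ} (hα0 : 0 ≤ α) (hα1 : α ≤ 1) {G : SimpleGraph V}
    (hG : G.IsTree) {a : V} (ha : 3 ≤ G.degree a) :
    ∃ H : SimpleGraph V, H.IsTree ∧ leafCount H < leafCount G ∧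
      alphaIndex α H ≤ alphaIndex α G ∧ dissociationNumber G ≤ dissociationNumber H + 1 := by
  have : Nontrivial V := by
    obtain ⟨w, hw⟩ := (G.degree_pos_iff_exists_adj a).1 (by omega)
    exact ⟨a, w, hw.ne⟩
  obtain ⟨p, k, hk, hp, hb⟩ := exists_isPendantPath hG ha
  -- The only neighbour of `p 0` on the path is `p 1`, so any other neighbour starts a branch off
  -- the path.
  obtain ⟨z, hz1, hz2⟩ : ∃ z ∈ G.neighborFinset (p 0), z ≠ p 1 :=
    Finset.exists_mem_ne (by rw [G.card_neighborFinset_eq_degree]; omega) _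
  rw [SimpleGraph.mem_neighborFinset] at hz1
  have hz : ∀ i ≤ k, p i ≠ z := by
    rintro i hi rfl
    have := (hp.adj_iff (Nat.zero_le k) hi).1 hz1
    obtain rfl : i = 1 := by omega
    exact hz2 rfl
  exact ⟨switchEdge G (p 0) z (p k),
    isTree_switchEdge hG hz1 (hz k le_rfl) (hp.not_adj_end hk hz) (hp.reachable_deleteEdges hz),
    leafCount_switchEdge_lt hk hp hz hz1 hb, alphaIndex_switchEdge_le hα0 hα1 hk hp hz hz1,
    dissociationNumber_le_switchEdge_add_one G _ _ _⟩

theorem exists_isTree_dissociationNumber_eq {α : ℝ} (hα0 : 0 ≤ α) (hα1 : α ≤ 1) {τ : ℕ}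
    (hτ : 2 * Fintype.card V ≤ 3 * τ) {G : SimpleGraph V} (hG : G.IsTree)
    (hGτ : τ ≤ dissociationNumber G) :
    ∃ H : SimpleGraph V, H.IsTree ∧ dissociationNumber H = τ ∧
      alphaIndex α H ≤ alphaIndex α G := by
  induction hm : leafCount G using Nat.strong_induction_on generalizing G with
  | _ m ih =>
    subst hm
    rcases hGτ.eq_or_lt with h | h
    · exact ⟨G, hG, h.symm, le_rfl⟩
    -- Exceeding `τ` gives 3·diss ≥ 3τ+3 ≥ 2n+3, just above the bound 2n+2 for maximum degree 2.
    · obtain ⟨a, ha⟩ : ∃ a, 3 ≤ G.degree a := by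
        by_contra! hc
        have := three_mul_dissociationNumber_le hG fun v => Nat.le_of_lt_succ (hc v)
        omega
      obtain ⟨H, hH, hlt, hle, hd⟩ := exists_isTree_leafCount_lt hα0 hα1 hG ha
      obtain ⟨H', h1, h2, h3⟩ := ih _ hlt hH (by omega) rfl
      exact ⟨H', h1, h2, h3.trans hle⟩

end Switching

end DissociationIndex

theorem theorem1p4 {V : Type*} [Fintype V] (n τ : ℕ) (hn : Fintype.card V = n)
    (hτ : ⌈(2 * (n : ℚ)) / 3⌉₊ ≤ τ) (α : ℝ) (hα0 : 0 ≤ α) (hα1 : α < 1)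
    (G : SimpleGraph V) (hG : G ∈ DissociationIndex.connectedGraphs V τ)
    (hmin : ∀ H ∈ DissociationIndex.connectedGraphs V τ,
      DissociationIndex.alphaIndex α G ≤ DissociationIndex.alphaIndex α H) :
    G.IsTree := by
  subst hn
  have hτ' : 2 * Fintype.card V ≤ 3 * τ := by
    rw [Nat.ceil_le, div_le_iff₀ (by norm_num)] at hτ
    have : 2 * Fintype.card V ≤ τ * 3 := by exact_mod_cast hτ
    omega
  obtain ⟨hconn, rfl⟩ := hG
  obtain ⟨T, hTG, hT⟩ := hconn.exists_isTree_le
  rcases hTG.eq_or_lt with rfl | hlt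
  · exact hT
  obtain ⟨H, hH, hHτ, hle⟩ := DissociationIndex.exists_isTree_dissociationNumber_eq hα0 hα1.le hτ'
    hT (DissociationIndex.dissociationNumber_anti hTG)
  have h1 := hmin H ⟨hH.connected, hHτ⟩
  have h2 := DissociationIndex.alphaIndex_lt_of_lt hα0 hα1 hT.connected hlt
  exact absurd (h1.trans hle) h2.not_ge
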